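/- Let $\mathbb{N}$ denote the set of positive integers and let $K$ be a field of characteristic $0$ (for instance $\mathbb{Q}$ or $\mathbb{R}$). For a finite multigraph $G$ (loops and parallel edges allowed) and a finite simple graph $H$, let $\hom(G,H)$ be the number of maps $V(G)\to V(H)$ that send every edge of $G$ to an edge of $H$. A sequence $(H_{\mathbf{k}})$ of finite simple graphs indexed by $\mathbf{k}=(k_1,\ldots,k_h)\in\mathbb{N}^h$ is called a *polynomial sequence* if for every finite multigraph $G$ there is a finite set $P_G\subset K[x_1,\ldots,x_h]$ such that for every $\mathbf{k}\in\mathbb{N}^h$ there is $p\in P_G$ with $\hom(G,H_{\mathbf{k}})=p(\mathbf{k})$; it is called a *strongly polynomial sequence* if for every finite multigraph $G$ there is a single polynomial $p_G\in K[x_1,\ldots,x_h]$ with $\hom(G,H_{\mathbf{k}})=p_G(\mathbf{k})$ for all $\mathbf{k}\in\mathbb{N}^h$. The line graph $L(H)$ of a simple graph $H$ has the edges of $H$ as its vertices, two distinct edges being adjacent if they share an endpoint. **Proposition.** Let $(H_{\mathbf{k}})_{\mathbf{k}\in\mathbb{N}^h}$ be a sequence of finite simple graphs. (i) If $(H_{\mathbf{k}})$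 is a polynomial sequence, then the sequence $(L(H_{\mathbf{k}}))$ of line graphs is a polynomial sequence. (ii) If $(H_{\mathbf{k}})$ is a strongly polynomial sequence, then the sequence $(L(H_{\mathbf{k}}))$ of line graphs is a strongly polynomial sequence. -/

import Mathlib

/-- A multigraph on the vertex set `V`: a multiset of edges, each of which is an unordered pair of
vertices. Loops and parallel edges are allowed. -/
structure Multigraph (V : Type*) where
  /-- the edges, with multiplicity -/
  edges : Multiset (Sym2 V)

/-- The homomorphism number `hom(G, H)` for a multigraph `G` and a simple graph `H`: the number of
maps from the vertices of `G` to the vertices of `H` which send every edge of `G` to an edge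
of `H`. (As `H` is simple, such a vertex map determines the image of each edge.) -/
noncomputable def homNumber {V W : Type*} (G : Multigraph V) (H : SimpleGraph W) : ℕ :=
  Nat.card {f : V → W // ∀ e ∈ G.edges, e.map f ∈ H.edgeSet}

/-- A sequence of simple graphs, indexed by `h`-tuples of positive integers, is a polynomial
sequence (over the coefficient field `K`) if for every finite multigraph `G` there is a finite set
of polynomials in `h` variables such that each `hom(G, H_k)` is the value at `k` of one of them. -/
def IsPolynomialSequence (K : Type*) [Field K] {h : ℕ} {W : (Fin h → ℕ+) → Type*}
    (H : ∀ k, SimpleGraph (W k)) : Prop :=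
  ∀ (V : Type) [Finite V] (G : Multigraph V), ∃ P : Finset (MvPolynomial (Fin h) K),
    ∀ k : Fin h → ℕ+, ∃ p ∈ P,
      (homNumber G (H k) : K) = MvPolynomial.eval (fun i => ((k i : ℕ) : K)) p

/-- A sequence of simple graphs, indexed by `h`-tuples of positive integers, is a strongly
polynomial sequence (over the coefficient field `K`) if for every finite multigraph `G` there is a
single polynomial in `h` variables whose value at each `k` is `hom(G, H_k)`. -/
def IsStronglyPolynomialSequence (K : Type*) [Field K] {h : ℕ} {W : (Fin h → ℕ+) → Type*}
    (H : ∀ k, SimpleGraph (W k)) : Prop :=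
  ∀ (V : Type) [Finite V] (G : Multigraph V), ∃ p : MvPolynomial (Fin h) K,
    ∀ k : Fin h → ℕ+,
      (homNumber G (H k) : K) = MvPolynomial.eval (fun i => ((k i : ℕ) : K)) p

/-! A map from `V` to the edges of `H`, with an orientation of each image edge, is a homomorphism to
`H` from a matching of `|V|` disjoint edges. Whether it respects line graph adjacency depends only
on which of the endpoints coincide. Homomorphisms with a prescribed coincidence pattern are counted
by inclusion-exclusion from homomorphisms out of quotients of the matching, which are multigraphs.
So `hom(G, L(H_k))` is a linear combination, with rational coefficients independent of `k`, of
numbers `hom(G', H_k)`, and both kinds of polynomial behaviour are closed under linear combinations.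
-/

/-- The image of a multigraph under a map of its vertices. -/
def Multigraph.map {U V : Type*} (f : U → V) (G : Multigraph U) : Multigraph V :=
  ⟨G.edges.map (Sym2.map f)⟩

/-- The homomorphism condition on a vertex map. -/
def Multigraph.IsHom {V W : Type*} (G : Multigraph V) (H : SimpleGraph W) (f : V → W) : Prop :=
  ∀ e ∈ G.edges, e.map f ∈ H.edgeSet

/-- Homomorphisms out of the multigraph obtained from `G` by identifying the pairs in `S` are the
homomorphisms out of `G` which identify these pairs. -/
theorem homNumber_map_quot {U W : Type*} (G : Multigraph U) (H : SimpleGraph W)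
    (S : Finset (U × U)) :
    homNumber (G.map (Quot.mk fun x y => (x, y) ∈ S)) H =
      Nat.card {g : U → W // G.IsHom H g ∧ ∀ p ∈ S, g p.1 = g p.2} := by
  refine Nat.card_congr
    { toFun := fun f => ⟨fun u => f.1 (Quot.mk _ u), fun e he => ?_, fun p hp => ?_⟩
      invFun := fun g => ⟨Quot.lift g.1 fun a b hab => g.2.2 (a, b) hab, fun e' he' => ?_⟩
      left_inv := fun f => ?_
      right_inv := fun g => ?_ }
  · have := f.2 _ (Multiset.mem_map_of_mem _ he)
    rwa [Sym2.map_map] at this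
  · exact congrArg f.1 (Quot.sound hp)
  · obtain ⟨e, he, rfl⟩ := Multiset.mem_map.1 he'
    rw [Sym2.map_map]
    exact g.2.1 e he
  · ext x
    induction x using Quot.ind
    rfl
  · rfl

/-- Polynomial-type families are determined by a module of functions: if all homomorphism numbers
into `H k` lie in `M`, then so do the numbers of homomorphisms satisfying prescribed equalities and
inequalities between images. -/
theorem card_isHom_eq_ne_mem {K ι : Type*} [Field K] {W : ι → Type*} [∀ k, Finite (W k)]
    (H : ∀ k, SimpleGraph (W k)) (M : Submodule K (ι → K))
    (hM : ∀ (V : Type) [Finite V] (G : Multigraph V), (fun k => (homNumber G (H k) : K)) ∈ M)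
    {U : Type} [Finite U] (G : Multigraph U) (D S : Finset (U × U)) :
    (fun k => (Nat.card {g : U → W k // (G.IsHom (H k) g ∧ ∀ p ∈ S, g p.1 = g p.2) ∧
      ∀ p ∈ D, g p.1 ≠ g p.2} : K)) ∈ M := by
  classical
  induction D using Finset.induction_on generalizing S with
  | empty =>
    simp only [Finset.notMem_empty, false_imp_iff, implies_true, and_true, ← homNumber_map_quot]
    exact hM _ _
  | insert d D hd ih =>
    -- Maps separating the pair `d` are all maps minus those that identify it.
    convert M.sub_mem (ih S) (ih (insert d S)) using 1
    ext k
    have := Fintype.ofFinite U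
    have := Fintype.ofFinite (W k)
    rw [Pi.sub_apply, eq_sub_iff_add_eq, ← Nat.cast_add]
    simp only [Nat.card_eq_fintype_card, Fintype.card_subtype]
    rw [← Finset.card_filter_add_card_filter_not (s := {g : U → W k |
      (G.IsHom (H k) g ∧ ∀ p ∈ S, g p.1 = g p.2) ∧ ∀ p ∈ D, g p.1 ≠ g p.2})
      (fun g => g d.1 = g d.2), add_comm, Finset.filter_filter, Finset.filter_filter]
    congr 4 <;> ext g <;> simp only [Finset.forall_mem_insert] <;> tauto

/-- The number of homomorphisms whose coincidence relation satisfies a property. -/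
theorem card_isHom_ker_mem {K ι : Type*} [Field K] {W : ι → Type*} [∀ k, Finite (W k)]
    (H : ∀ k, SimpleGraph (W k)) (M : Submodule K (ι → K))
    (hM : ∀ (V : Type) [Finite V] (G : Multigraph V), (fun k => (homNumber G (H k) : K)) ∈ M)
    {U : Type} [Finite U] (G : Multigraph U) (Φ : Set (U × U) → Prop) :
    (fun k => (Nat.card {g : U → W k // G.IsHom (H k) g ∧ Φ {p | g p.1 = g p.2}} : K)) ∈ M := by
  classical
  have := Fintype.ofFinite U
  -- Sort the maps by their exact coincidence set `S`: equality on `S`, inequality on `Sᶜ`. Sets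
  -- that are not equivalence relations contribute 0.
  convert M.sum_mem (t := {S : Finset (U × U) | Φ S})
    fun S _ => card_isHom_eq_ne_mem H M hM G Sᶜ S using 1
  ext k
  have := Fintype.ofFinite (W k)
  rw [Finset.sum_apply, ← Nat.cast_sum]
  simp only [Nat.card_eq_fintype_card, Fintype.card_subtype]
  rw [Finset.card_eq_sum_card_fiberwise
    (f := fun g : U → W k => ({p : U × U | g p.1 = g p.2} : Finset (U × U)))
    (t := {S : Finset (U × U) | Φ S}) fun g hg => by simpa using (Finset.mem_filter.1 hg).2.2]
  refine congrArg _ (Finset.sum_congr rfl fun S hS => congrArg _ ?_)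
  rw [Finset.filter_filter]
  ext g
  simp only [Finset.mem_filter, Finset.mem_univ, true_and, Finset.mem_compl] at hS ⊢
  constructor
  · rintro ⟨⟨hg, -⟩, rfl⟩
    simpa using hg
  · rintro ⟨⟨hg, h₁⟩, h₂⟩
    have h : ({p : U × U | g p.1 = g p.2} : Finset (U × U)) = S := by
      ext p
      simpa using ⟨fun hp => by_contra fun hpS => h₂ p hpS hp, h₁ p⟩
    refine ⟨⟨hg, ?_⟩, h⟩
    rw [← h] at hS
    simpa using hS

/-- The multigraph consisting of one disjoint edge for each element of `V`. -/
def Multigraph.matching (V : Type*) [Fintype V] : Multigraph (V × Bool) :=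
  ⟨Finset.univ.val.map fun v => s((v, false), (v, true))⟩

theorem Multigraph.isHom_matching_iff {V W : Type*} [Fintype V] (H : SimpleGraph W)
    (g : V × Bool → W) :
    (Multigraph.matching V).IsHom H g ↔ ∀ v, s(g (v, false), g (v, true)) ∈ H.edgeSet := by
  simp [Multigraph.IsHom, Multigraph.matching]

/-- The property of the coincidence relation of a family of oriented edges, indexed by `V`, which
says that the edges indexed by adjacent vertices of `G` are adjacent in the line graph. -/
def Multigraph.LineRel {V : Type*} (G : Multigraph V) (X : Set ((V × Bool) × (V × Bool))) : Prop :=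
  ∀ u v, s(u, v) ∈ G.edges →
    ¬(((u, false), (v, false)) ∈ X ∧ ((u, true), (v, true)) ∈ X ∨
      ((u, false), (v, true)) ∈ X ∧ ((u, true), (v, false)) ∈ X) ∧
    ∃ i j, ((u, i), (v, j)) ∈ X

/-- Two edges are equal iff their ends agree in one of the two orders, and they meet iff some ends
agree. A loop of `G` makes both sides false. -/
theorem Multigraph.lineRel_iff {V W : Type*} (G : Multigraph V) (H : SimpleGraph W)
    (f : V → H.edgeSet) (g : V × Bool → W) (hfg : ∀ v, s(g (v, false), g (v, true)) = (f v).1) :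
    G.LineRel {p | g p.1 = g p.2} ↔ G.IsHom H.lineGraph f := by
  have key : ∀ u v, s(u, v).map f ∈ H.lineGraph.edgeSet ↔
      ¬(g (u, false) = g (v, false) ∧ g (u, true) = g (v, true) ∨
        g (u, false) = g (v, true) ∧ g (u, true) = g (v, false)) ∧
      ∃ i j, g (u, i) = g (v, j) := by
    intro u v
    rw [Sym2.map_mk, SimpleGraph.mem_edgeSet, SimpleGraph.lineGraph, ← Sym2.eq_iff, hfg, hfg]
    refine and_congr (by rw [Ne, Subtype.ext_iff]) ?_
    rw [← hfg, ← hfg]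
    simp only [Set.Nonempty, Set.mem_inter_iff, SetLike.mem_coe, Sym2.mem_iff, Bool.exists_bool]
    constructor
    · rintro ⟨x, rfl | rfl, h | h⟩ <;> simp [h]
    · rintro ((h | h) | (h | h))
      · exact ⟨_, .inl rfl, .inl h⟩
      · exact ⟨_, .inl rfl, .inr h⟩
      · exact ⟨_, .inr rfl, .inl h⟩
      · exact ⟨_, .inr rfl, .inr h⟩
  constructor
  · intro h e
    induction e using Sym2.ind with
    | _ u v => exact fun he => (key u v).2 (h u v he)
  · exact fun h u v he => (key u v).1 (h _ he)

/-- Homomorphisms to the line graph, together with an orientation of the edge assigned to each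
vertex, are homomorphisms of a matching subject to a condition on coincidences. -/
theorem homNumber_lineGraph_mul {V W : Type*} [Fintype V] (G : Multigraph V) (H : SimpleGraph W) :
    homNumber G H.lineGraph * 2 ^ Fintype.card V =
      Nat.card {g : V × Bool → W //
        (Multigraph.matching V).IsHom H g ∧ G.LineRel {p | g p.1 = g p.2}} := by
  classical
  have hout : ∀ e : H.edgeSet, ∃ p : Bool → W, s(p false, p true) = e.1 := by
    rintro ⟨e, he⟩
    induction e using Sym2.ind with
    | _ a b => exact ⟨fun i => if i then b else a, rfl⟩
  choose p hp using hout
  -- As `H` has no loops, each edge has exactly two orientations, whence the factor `2 ^ |V|`.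
  have hne : ∀ e, p e false ≠ p e true := fun e => by
    have := e.2
    rw [← hp e] at this
    exact this.ne
  have hpx : ∀ e b, s(p e (b ^^ false), p e (b ^^ true)) = e.1 := by
    rintro e (_ | _)
    · exact hp e
    · exact Sym2.eq_swap.trans (hp e)
  have hcard : 2 ^ Fintype.card V = Nat.card (V → Bool) := by simp
  rw [hcard, homNumber, ← Nat.card_prod]
  -- The bit `x.2 v` tells whether the reference orientation `p` of the edge at `v` is reversed.
  refine Nat.card_congr (Equiv.ofBijective (fun x =>
    ⟨fun y => p (x.1.1 y.1) (x.2 y.1 ^^ y.2), ?_, ?_⟩) ⟨?_, ?_⟩)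
  · rw [Multigraph.isHom_matching_iff]
    intro v
    rw [hpx]
    exact (x.1.1 v).2
  · exact (G.lineRel_iff H x.1.1 (fun y => p (x.1.1 y.1) (x.2 y.1 ^^ y.2)) fun v => hpx _ _).2 x.1.2
  · rintro ⟨⟨f, hf⟩, b⟩ ⟨⟨f', hf'⟩, b'⟩ h
    have h' : ∀ v i, p (f v) (b v ^^ i) = p (f' v) (b' v ^^ i) :=
      fun v i => congrFun (congrArg Subtype.val h) (v, i)
    have hff : f = f' := by
      ext1 v
      rw [Subtype.ext_iff, ← hpx (f v) (b v), ← hpx (f' v) (b' v), h', h']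
    subst hff
    have hbb : b = b' := by
      ext1 v
      have h₁ := h' v false
      have h₂ := hne (f v)
      cases hb : b v <;> cases hb' : b' v <;> simp_all
    rw [hbb]
  · rintro ⟨g, hg, hG⟩
    rw [Multigraph.isHom_matching_iff] at hg
    let f : V → H.edgeSet := fun v => ⟨_, hg v⟩
    have hb : ∀ v, ∃ b, ∀ i, p (f v) (b ^^ i) = g (v, i) := by
      intro v
      rcases Sym2.eq_iff.1 (hp (f v)) with ⟨h₁, h₂⟩ | ⟨h₁, h₂⟩
      · exact ⟨false, fun i => by cases i <;> simpa⟩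
      · exact ⟨true, fun i => by cases i <;> simpa⟩
    choose b hb using hb
    refine ⟨(⟨f, (G.lineRel_iff H f g fun v => rfl).1 hG⟩, b), Subtype.ext ?_⟩
    ext1 y
    exact hb y.1 y.2

/-- If the homomorphism numbers into `H k` lie in a module of functions of `k`, then so do the
homomorphism numbers into the line graphs. -/
theorem homNumber_lineGraph_mem {K ι : Type*} [Field K] [CharZero K] {W : ι → Type*}
    [∀ k, Finite (W k)] (H : ∀ k, SimpleGraph (W k)) (M : Submodule K (ι → K))
    (hM : ∀ (V : Type) [Finite V] (G : Multigraph V), (fun k => (homNumber G (H k) : K)) ∈ M)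
    (V : Type) [Finite V] (G : Multigraph V) :
    (fun k => (homNumber G (H k).lineGraph : K)) ∈ M := by
  have := Fintype.ofFinite V
  convert M.smul_mem ((2 ^ Fintype.card V : K)⁻¹)
    (card_isHom_ker_mem H M hM (Multigraph.matching V) G.LineRel) using 1
  ext k
  rw [Pi.smul_apply, ← homNumber_lineGraph_mul, smul_eq_mul]
  push_cast
  field_simp

/-- Functions whose values are, at each point, given by one of finitely many polynomials. -/
def finitelyMvPolynomialFunctions (K : Type*) [Field K] {ι σ : Type*} (c : ι → σ → K) :
    Submodule K (ι → K) where
  carrier := {F | ∃ P : Finset (MvPolynomial σ K), ∀ k, ∃ p ∈ P, F k = MvPolynomial.eval (c k) p}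
  zero_mem' := ⟨{0}, fun k => ⟨0, by simp⟩⟩
  add_mem' := by
    classical
    rintro F F' ⟨P, hP⟩ ⟨P', hP'⟩
    -- The choices from `P` and `P'` vary separately with `k`, so all pairwise sums are admitted.
    refine ⟨Finset.image₂ (· + ·) P P', fun k => ?_⟩
    obtain ⟨p, hp, h⟩ := hP k
    obtain ⟨p', hp', h'⟩ := hP' k
    exact ⟨p + p', Finset.mem_image₂_of_mem hp hp', by simp [h, h']⟩
  smul_mem' := by
    classical
    rintro a F ⟨P, hP⟩
    refine ⟨P.image (a • ·), fun k => ?_⟩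
    obtain ⟨p, hp, h⟩ := hP k
    exact ⟨a • p, Finset.mem_image_of_mem _ hp, by simp [h, MvPolynomial.smul_eval]⟩

/-- Functions given by a single polynomial. -/
def mvPolynomialFunctions (K : Type*) [Field K] {ι σ : Type*} (c : ι → σ → K) :
    Submodule K (ι → K) where
  carrier := {F | ∃ p : MvPolynomial σ K, ∀ k, F k = MvPolynomial.eval (c k) p}
  zero_mem' := ⟨0, by simp⟩
  add_mem' := by
    rintro F F' ⟨p, hp⟩ ⟨p', hp'⟩
    exact ⟨p + p', fun k => by simp [hp, hp']⟩
  smul_mem' := by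
    rintro a F ⟨p, hp⟩
    exact ⟨a • p, fun k => by simp [hp, MvPolynomial.smul_eval]⟩

theorem mainTheorem8 (K : Type*) [Field K] [CharZero K] {h : ℕ} {W : (Fin h → ℕ+) → Type*}
    [∀ k, Finite (W k)] (H : ∀ k, SimpleGraph (W k)) :
    (IsPolynomialSequence K H → IsPolynomialSequence K (fun k => (H k).lineGraph)) ∧
    (IsStronglyPolynomialSequence K H →
      IsStronglyPolynomialSequence K (fun k => (H k).lineGraph)) :=
  ⟨fun hH => homNumber_lineGraph_mem H
      (finitelyMvPolynomialFunctions K fun (k : Fin h → ℕ+) i => ((k i : ℕ) : K)) hH,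
    fun hH => homNumber_lineGraph_mem H
      (mvPolynomialFunctions K fun (k : Fin h → ℕ+) i => ((k i : ℕ) : K)) hH⟩
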